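/- All C*-algebras are complex. For a (not necessarily unital) C*-algebra $A$ let $$\phi_A:\{(a,b)\in A\times A \mid a>0,\ b>0,\ \|a\|=\|b\|=1,\ ab=0\}\to A,\qquad \phi_A(a,b)=a+b,$$ where $a>0$ means that $a$ is positive and nonzero. If $A$ is unital, put $$d=\inf\{\|a+b-1\| \mid a>0,\ b>0,\ \|a\|=\|b\|=1,\ ab=0\}.$$ A C*-subalgebra $B\subseteq A$ is hereditary if $b\in B$, $a\in A$ and $0\le a\le b$ imply $a\in B$; an injective $*$-homomorphism $B\to A$ of C*-algebras is a hereditary embedding if its image is a hereditary C*-subalgebra of $A$. **Proposition 3.** Let $A$ be a unital C*-algebra. 1. The image of $\phi_A$ is contained in the unit sphere of $A$. If $\dim A>1$, then the set of numbers $\|a+b-1\|$ whose infimum is $d$ is nonempty, $d\in\{0,1\}$, and $d=1$ if and only if $A$ has no projection ($p=p^*=p^2$) other than $0$ and $1$. 2. If the image of $\phi_A$ is closed in $A$, then the image of $\phi_B$ is closed in $B$ for every hereditary C*-subalgebra $B$ of $A$ (unital or not), and, more generally, for every C*-algebra $B$ that admits a hereditary embedding into $A$. 3. If $\dim A>1$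 and the image of $\phi_A$ is a finite set, then it is equal to $\{1\}$ and $A$ is $*$-isomorphic to $\mathbb{C}^2$ or to $M_2(\mathbb{C})$. 4. The image of $\phi_A$ is compact if and only if $A$ is finite-dimensional. -/

import Mathlib

section OrthogonalSums

/- Every C⋆-algebra carries its standard order: `x ≤ y` iff `y - x` is self-adjoint with
nonnegative spectrum. -/
attribute [local instance] CStarAlgebra.spectralOrder

/-- The pairs `(a, b)` with `a > 0`, `b > 0`, `‖a‖ = ‖b‖ = 1` and `ab = 0`
in a (possibly non-unital) C⋆-algebra. -/
def orthPairs (A : Type*) [NonUnitalCStarAlgebra A] : Set (A × A) :=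
  {p | 0 < p.1 ∧ 0 < p.2 ∧ ‖p.1‖ = 1 ∧ ‖p.2‖ = 1 ∧ p.1 * p.2 = 0}

/-- The addition map `φ_A (a, b) = a + b`. -/
def orthAdd (A : Type*) [NonUnitalCStarAlgebra A] : orthPairs A → A :=
  fun p => p.1.1 + p.1.2

/-- The image of `φ_A`. -/
def orthImage (A : Type*) [NonUnitalCStarAlgebra A] : Set A :=
  Set.range (orthAdd A)

/-- The numbers `‖a + b - 1‖`, for `(a, b)` in the domain of `φ_A`. -/
def orthDistances (A : Type*) [CStarAlgebra A] : Set ℝ :=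
  {r | ∃ p ∈ orthPairs A, r = ‖p.1 + p.2 - 1‖}

/-- The infimum `d` of the numbers `‖a + b - 1‖`. -/
noncomputable def orthDist (A : Type*) [CStarAlgebra A] : ℝ :=
  sInf (orthDistances A)

/-- A ⋆-subalgebra `S` of `A` is hereditary if `b ∈ S` and `0 ≤ a ≤ b` in `A` imply `a ∈ S`. -/
def IsHereditarySubalgebra {A : Type*} [NonUnitalCStarAlgebra A]
    (S : NonUnitalStarSubalgebra ℂ A) : Prop :=
  ∀ a b : A, b ∈ S → 0 ≤ a → a ≤ b → a ∈ S

/-- A hereditary embedding: an injective ⋆-homomorphism with hereditary range. (The range of an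
injective ⋆-homomorphism of C⋆-algebras is automatically closed.) -/
def IsHereditaryEmbedding {A B : Type*} [NonUnitalCStarAlgebra A] [NonUnitalCStarAlgebra B]
    (ψ : B →⋆ₙₐ[ℂ] A) : Prop :=
  Function.Injective ψ ∧ IsHereditarySubalgebra (NonUnitalStarAlgHom.range ψ)

end OrthogonalSums

/-! Orthogonal self-adjoint elements satisfy `‖a ± b‖ = max ‖a‖ ‖b‖`, so every sum in the image has
norm one. If `‖a + b - 1‖ < 1`, then `a + b` is invertible and `(a + b)⁻¹ * a` is a nontrivial
projection; conversely a nontrivial projection `p` gives distance zero through `(p, 1 - p)`. Hence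
the dichotomy for `d`.

For a hereditary embedding `ψ`, the image of `φ_B` is exactly the preimage of the image of `φ_A`:
both summands are dominated by their sum, hence lie in the range.

A compact image excludes infinite orthogonal families (`IsOrthFamily.false_of_isCompact`). So
self-adjoint elements have finite spectrum and projections satisfy the descending chain condition;
`1` is then a finite sum of projections with scalar corners, and `A` is a finite sum of spaces `p *
A * q` of dimension at most one.

A finite image excludes even three orthogonal elements (`orthImage_infinite_of_three`), so `1 = p +
q` with scalar corners. Then `A` is `ℂ²` or `M₂(ℂ)` according to whether `p * A * q` vanishes. -/

section OrthogonalSums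

attribute [local instance] CStarAlgebra.spectralOrder CStarAlgebra.spectralOrderedRing

/-! ### Orthogonal positive elements of norm one -/

section NonUnital

variable {A : Type*} [NonUnitalCStarAlgebra A]

theorem mem_orthPairs {a b : A} (ha : 0 ≤ a) (hb : 0 ≤ b) (ha1 : ‖a‖ = 1) (hb1 : ‖b‖ = 1)
    (hab : a * b = 0) : (a, b) ∈ orthPairs A :=
  ⟨ha.lt_of_ne (by rintro rfl; simp at ha1), hb.lt_of_ne (by rintro rfl; simp at hb1),
    ha1, hb1, hab⟩

theorem mem_orthImage_iff {x : A} : x ∈ orthImage A ↔ ∃ a b : A,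
    0 ≤ a ∧ 0 ≤ b ∧ ‖a‖ = 1 ∧ ‖b‖ = 1 ∧ a * b = 0 ∧ a + b = x := by
  constructor
  · rintro ⟨⟨⟨a, b⟩, ha, hb, ha1, hb1, hab⟩, rfl⟩
    exact ⟨a, b, ha.le, hb.le, ha1, hb1, hab, rfl⟩
  · rintro ⟨a, b, ha, hb, ha1, hb1, hab, rfl⟩
    exact ⟨⟨(a, b), mem_orthPairs ha hb ha1 hb1 hab⟩, rfl⟩

theorem norm_add_eq_one_of_orth {a b : A} (ha : 0 ≤ a) (hb : 0 ≤ b) (ha1 : ‖a‖ = 1)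
    (hb1 : ‖b‖ = 1) (hab : a * b = 0) : ‖a + b‖ = 1 := by
  rw [(IsSelfAdjoint.of_nonneg ha).norm_add_eq_max (.of_nonneg hb) hab, ha1, hb1, max_self]

theorem orthImage_subset_sphere : orthImage A ⊆ Metric.sphere (0 : A) 1 := by
  intro x hx
  obtain ⟨a, b, ha, hb, ha1, hb1, hab, rfl⟩ := mem_orthImage_iff.1 hx
  simpa using norm_add_eq_one_of_orth ha hb ha1 hb1 hab

theorem mul_eq_zero_symm_of_nonneg {a b : A} (ha : 0 ≤ a) (hb : 0 ≤ b) (hab : a * b = 0) :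
    b * a = 0 := by
  simpa [ha.star_eq, hb.star_eq] using congr(star $hab)

/-- A family of pairwise orthogonal positive elements of norm one. -/
structure IsOrthFamily {ι : Type*} (e : ι → A) : Prop where
  nonneg : ∀ i, 0 ≤ e i
  norm_eq : ∀ i, ‖e i‖ = 1
  mul_eq : ∀ i j, i ≠ j → e i * e j = 0

/-- With `e 0` kept as a fixed partner, the sums `e 0 + e (n + 1)` lie at mutual distance one, so no
subsequence is Cauchy. -/
theorem IsOrthFamily.false_of_isCompact {e : ℕ → A} (he : IsOrthFamily e)
    (h : IsCompact (orthImage A)) : False := by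
  have hmem : ∀ n, e 0 + e (n + 1) ∈ orthImage A := fun n =>
    mem_orthImage_iff.2 ⟨_, _, he.nonneg _, he.nonneg _, he.norm_eq _, he.norm_eq _,
      he.mul_eq _ _ (by lia), rfl⟩
  obtain ⟨x, -, φ, hφ, hlim⟩ := h.tendsto_subseq hmem
  obtain ⟨N, hN⟩ := Metric.cauchySeq_iff'.1 hlim.cauchySeq 1 one_pos
  have h1 := hN (N + 1) (by lia)
  have hne : φ (N + 1) + 1 ≠ φ N + 1 := by
    have := hφ (Nat.lt_succ_self N)
    lia
  rw [Function.comp_apply, Function.comp_apply, dist_eq_norm, add_sub_add_left_eq_sub,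
    (IsSelfAdjoint.of_nonneg (he.nonneg _)).norm_sub_eq_max (.of_nonneg (he.nonneg _))
      (he.mul_eq _ _ hne), he.norm_eq, he.norm_eq, max_self] at h1
  exact lt_irrefl _ h1

/-- The third element can be added to `b` with any weight in `[0, 1]` without changing the norm,
which gives a whole segment in the image. -/
theorem orthImage_infinite_of_three {a b c : A} (ha : 0 ≤ a) (hb : 0 ≤ b) (hc : 0 ≤ c)
    (ha1 : ‖a‖ = 1) (hb1 : ‖b‖ = 1) (hc1 : ‖c‖ = 1) (hab : a * b = 0) (hac : a * c = 0)
    (hbc : b * c = 0) : (orthImage A).Infinite := by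
  have hmem : ∀ t ∈ Set.Icc (0 : ℝ) 1, a + (b + t • c) ∈ orthImage A := by
    intro t ht
    have htc : 0 ≤ t • c := smul_nonneg ht.1 hc
    refine mem_orthImage_iff.2 ⟨_, _, ha, add_nonneg hb htc, ha1, ?_, ?_, rfl⟩
    · rw [(IsSelfAdjoint.of_nonneg hb).norm_add_eq_max (.of_nonneg htc)
        (by rw [mul_smul_comm, hbc, smul_zero]), hb1, norm_smul, hc1, mul_one,
        Real.norm_of_nonneg ht.1, max_eq_left ht.2]
    · rw [mul_add, mul_smul_comm, hab, hac, smul_zero, add_zero]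
  refine Set.infinite_of_injOn_mapsTo (s := Set.Icc (0 : ℝ) 1)
    (f := fun t => a + (b + t • c)) ?_ hmem (Set.Icc_infinite one_pos)
  intro s _ t _ hst
  have hc0 : c ≠ 0 := by rintro rfl; simp at hc1
  exact smul_left_injective ℝ hc0 (add_left_cancel (add_left_cancel hst))

end NonUnital

/-! ### Hereditary embeddings -/

section Hereditary

variable {A B : Type*} [NonUnitalCStarAlgebra A] [NonUnitalCStarAlgebra B]

/-- The extension of `ψ` to the unitizations is still injective, hence preserves real spectra, and
positivity is read off the spectrum. -/
theorem nonneg_of_map_nonneg_of_injective (ψ : B →⋆ₙₐ[ℂ] A) (hψ : Function.Injective ψ) {b : B}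
    (hb : 0 ≤ ψ b) : 0 ≤ b := by
  have hsa : IsSelfAdjoint b := hψ (by rw [map_star, hb.star_eq])
  have hsa' : IsSelfAdjoint (b : Unitization ℂ B) := hsa.inr ℂ
  have hspec := hsa'.map_spectrum_real _ (Unitization.starMap_injective (φ := ψ) hψ)
  rw [Unitization.starMap_inr] at hspec
  rw [← Unitization.inr_nonneg_iff, StarOrderedRing.nonneg_iff_spectrum_nonneg (R := ℝ) _ hsa',
    ← hspec]
  exact (StarOrderedRing.nonneg_iff_spectrum_nonneg (R := ℝ) _
    (.of_nonneg (Unitization.inr_nonneg_iff.2 hb))).1 (Unitization.inr_nonneg_iff.2 hb)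

theorem isClosed_orthImage_of_isHereditaryEmbedding (hA : IsClosed (orthImage A))
    {ψ : B →⋆ₙₐ[ℂ] A} (hψ : IsHereditaryEmbedding ψ) : IsClosed (orthImage B) := by
  obtain ⟨hinj, hher⟩ := hψ
  have hnorm := NonUnitalStarAlgHom.norm_map ψ hinj
  have hpre : orthImage B = ψ ⁻¹' orthImage A := by
    ext x
    simp only [Set.mem_preimage, mem_orthImage_iff]
    constructor
    · rintro ⟨a, b, ha, hb, ha1, hb1, hab, rfl⟩
      exact ⟨ψ a, ψ b, map_nonneg ψ ha, map_nonneg ψ hb, by rw [hnorm, ha1], by rw [hnorm, hb1],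
        by rw [← map_mul, hab, map_zero], (map_add ψ a b).symm⟩
    · rintro ⟨a, b, ha, hb, ha1, hb1, hab, hx⟩
      have hxr : a + b ∈ NonUnitalStarAlgHom.range ψ := ⟨x, hx.symm⟩
      obtain ⟨a', rfl⟩ : ∃ a', ψ a' = a := hher a _ hxr ha (le_add_of_nonneg_right hb)
      obtain ⟨b', rfl⟩ : ∃ b', ψ b' = b := hher b _ hxr hb (le_add_of_nonneg_left ha)
      exact ⟨a', b', nonneg_of_map_nonneg_of_injective ψ hinj ha,
        nonneg_of_map_nonneg_of_injective ψ hinj hb, by rw [← hnorm, ha1], by rw [← hnorm, hb1],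
        hinj (by rw [map_mul, hab, map_zero]), hinj (by rw [map_add, hx])⟩
  rw [hpre]
  exact hA.preimage (NonUnitalStarAlgHom.isometry ψ hinj).continuous

theorem isHereditaryEmbedding_subtype {S : NonUnitalStarSubalgebra ℂ A} [IsClosed (S : Set A)]
    (hS : IsHereditarySubalgebra S) :
    IsHereditaryEmbedding (NonUnitalStarSubalgebraClass.subtype S) := by
  refine ⟨Subtype.val_injective, fun a b hb ha hab => ?_⟩
  obtain ⟨b, rfl⟩ := hb
  exact ⟨⟨a, hS a b b.2 ha hab⟩, rfl⟩

end Hereditary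

/-! ### Functional calculus in unital algebras and the number `d` -/

section Unital

variable {A : Type*} [CStarAlgebra A]

/-- Urysohn functions that vanish off `U i` and equal one at a point of `U i` are carried into `A`
by the isometric functional calculus. -/
theorem exists_isOrthFamily_of_isOpen {ι : Type*} {x : A} (hx : IsSelfAdjoint x)
    {U : ι → Set (spectrum ℝ x)} (hU : ∀ i, IsOpen (U i)) (hne : ∀ i, (U i).Nonempty)
    (hd : Pairwise (Function.onFun Disjoint U)) : ∃ e : ι → A, IsOrthFamily e := by
  choose y hy using hne
  have hsep : ∀ i, Disjoint (U i)ᶜ {y i} := fun i =>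
    Set.disjoint_singleton_right.2 fun h => h (hy i)
  choose f hf0 hf1 hf using fun i =>
    exists_continuous_zero_one_of_isClosed (hU i).isClosed_compl isClosed_singleton (hsep i)
  refine ⟨fun i => cfcHom hx (f i), fun i => ?_, fun i => ?_, fun i j hij => ?_⟩
  · exact (cfcHom_nonneg_iff hx).2 fun t => (hf i t).1
  · rw [norm_cfcHom x (f i) hx]
    refine le_antisymm ((ContinuousMap.norm_le _ zero_le_one).2 fun t => ?_) ?_
    · rw [Real.norm_of_nonneg (hf i t).1]
      exact (hf i t).2
    · simpa [hf1 i rfl] using (f i).norm_coe_le_norm (y i)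
  · suffices h : f i * f j = 0 by rw [← map_mul, h, map_zero]
    ext t
    by_cases ht : t ∈ U i
    · have : t ∉ U j := Set.disjoint_left.1 (hd hij) ht
      simp [hf0 j this]
    · simp [hf0 i ht]

theorem spectrum_finite_of_isCompact_orthImage (h : IsCompact (orthImage A)) {x : A}
    (hx : IsSelfAdjoint x) : (spectrum ℝ x).Finite := by
  by_contra hinf
  have : Infinite (spectrum ℝ x) := Set.infinite_coe_iff.2 hinf
  obtain ⟨U, hU, hUo, hd⟩ := exists_seq_infinite_isOpen_pairwise_disjoint (spectrum ℝ x)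
  obtain ⟨e, he⟩ := exists_isOrthFamily_of_isOpen hx hUo (fun n => (hU n).nonempty) hd
  exact he.false_of_isCompact h

/-- If all compressions `p * x * p` of self-adjoint `x` were scalar, splitting `a` into real and
imaginary parts would make the whole corner scalar. -/
theorem exists_isSelfAdjoint_not_smul {p : A} (hp : IsStarProjection p)
    (h : ¬ ∀ a : A, ∃ c : ℂ, p * a * p = c • p) :
    ∃ x : A, IsSelfAdjoint x ∧ p * x = x ∧ x * p = x ∧ ∀ c : ℂ, x ≠ c • p := by
  have hpp : p * p = p := hp.isIdempotentElem
  by_contra! hcon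
  refine h fun a => ?_
  have key : ∀ x : A, IsSelfAdjoint x → ∃ c : ℂ, p * x * p = c • p := by
    intro x hx
    apply hcon
    · simpa [hp.isSelfAdjoint.star_eq] using hx.conjugate p
    · simp only [← mul_assoc, hpp]
    · simp only [mul_assoc, hpp]
  obtain ⟨c, hc⟩ := key _ (realPart a).2
  obtain ⟨d, hd⟩ := key _ (imaginaryPart a).2
  refine ⟨c + Complex.I * d, ?_⟩
  nth_rw 1 [← realPart_add_I_smul_imaginaryPart a]
  rw [mul_add, add_mul, hc, mul_smul_comm, smul_mul_assoc, hd, smul_smul, add_smul]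

theorem exists_isSelfAdjoint_not_algebraMap (h : 1 < Module.rank ℂ A) :
    ∃ x : A, IsSelfAdjoint x ∧ ∀ c : ℂ, x ≠ c • (1 : A) := by
  have : ¬ ∀ a : A, ∃ c : ℂ, (1 : A) * a * 1 = c • (1 : A) := by
    intro hcon
    refine h.not_ge (rank_le_one_iff.2 ⟨1, fun a => ?_⟩)
    obtain ⟨c, hc⟩ := hcon a
    exact ⟨c, by simpa using hc.symm⟩
  obtain ⟨x, hx, -, -, hx'⟩ := exists_isSelfAdjoint_not_smul (.one A) this
  exact ⟨x, hx, hx'⟩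

theorem orthPairs_nonempty (h : 1 < Module.rank ℂ A) : (orthPairs A).Nonempty := by
  obtain ⟨x, hx, hxc⟩ := exists_isSelfAdjoint_not_algebraMap h
  have hnt : (spectrum ℝ x).Nontrivial := by
    rw [← Set.not_subsingleton_iff]
    intro hs
    have : ∃ r : ℝ, spectrum ℝ x ⊆ {r} := by
      rcases hs.eq_empty_or_singleton with h0 | ⟨r, hr⟩
      · exact ⟨0, by simp [h0]⟩
      · exact ⟨r, hr.le⟩
    obtain ⟨r, hr⟩ := this
    refine hxc (r : ℂ) ?_
    rw [CFC.eq_algebraMap_of_spectrum_subset_singleton x r hr hx, Algebra.algebraMap_eq_smul_one]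
    simp
  obtain ⟨s, hs, t, ht, hst⟩ := hnt
  obtain ⟨U, V, hU, hV, hsU, htV, hUV⟩ :=
    t2_separation (x := (⟨s, hs⟩ : spectrum ℝ x)) (y := ⟨t, ht⟩) (by simpa using hst)
  obtain ⟨e, he⟩ := exists_isOrthFamily_of_isOpen (ι := Bool) (U := fun b => cond b U V) hx
    (by rintro (_ | _) <;> assumption)
    (by rintro (_ | _); exacts [⟨_, htV⟩, ⟨_, hsU⟩])
    (by rintro (_ | _) (_ | _) h <;> simp_all [Function.onFun, disjoint_comm])
  exact ⟨(e true, e false), mem_orthPairs (he.nonneg _) (he.nonneg _) (he.norm_eq _)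
    (he.norm_eq _) (he.mul_eq _ _ (by simp))⟩

theorem IsStarProjection.norm_eq_one {p : A} (hp : IsStarProjection p) (h0 : p ≠ 0) :
    ‖p‖ = 1 := by
  have h : ‖p‖ * ‖p‖ = ‖p‖ := by
    rw [← pow_two, ← hp.isSelfAdjoint.norm_mul_self, hp.isIdempotentElem.eq]
  exact mul_left_cancel₀ (norm_ne_zero_iff.2 h0) (by rw [h, mul_one])

theorem one_sub_mem_orthPairs {p : A} (hp : IsStarProjection p) (h0 : p ≠ 0) (h1 : p ≠ 1) :
    (p, 1 - p) ∈ orthPairs A :=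
  mem_orthPairs hp.nonneg hp.one_sub.nonneg (hp.norm_eq_one h0)
    (hp.one_sub.norm_eq_one (sub_ne_zero.2 h1.symm)) hp.mul_one_sub_self

theorem norm_sub_one_le_one {a b : A} (h : (a, b) ∈ orthPairs A) : ‖a + b - 1‖ ≤ 1 := by
  obtain ⟨ha, hb, ha1, hb1, hab⟩ := h
  have h0 : 0 ≤ a + b := add_nonneg ha.le hb.le
  have h1 : a + b ≤ 1 := (CStarAlgebra.norm_le_one_iff_of_nonneg _ h0).1
    (norm_add_eq_one_of_orth ha.le hb.le ha1 hb1 hab).le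
  rw [norm_sub_rev, CStarAlgebra.norm_le_one_iff_of_nonneg _ (sub_nonneg.2 h1)]
  exact sub_le_self _ h0

theorem exists_isStarProjection_of_norm_sub_one_lt {a b : A} (h : (a, b) ∈ orthPairs A)
    (hlt : ‖a + b - 1‖ < 1) : ∃ p : A, IsStarProjection p ∧ p ≠ 0 ∧ p ≠ 1 := by
  obtain ⟨ha, hb, -, -, hab⟩ := h
  have hba := mul_eq_zero_symm_of_nonneg ha.le hb.le hab
  rw [norm_sub_rev] at hlt
  have hu : IsUnit (a + b) := by
    simpa using isUnit_one_sub_of_norm_lt_one hlt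
  obtain ⟨u, hu⟩ := hu
  have hau : a * u = a * a := by rw [hu, mul_add, hab, add_zero]
  have hua : (u : A) * a = a * a := by rw [hu, add_mul, hba, add_zero]
  have hcomm : Commute (u : A) a := hua.trans hau.symm
  have hcomm' : Commute (↑u⁻¹ : A) a := hcomm.units_inv_left
  have hsu : star u = u := by
    ext
    rw [Units.coe_star, hu, star_add, ha.le.star_eq, hb.le.star_eq]
  have hinv : star (↑u⁻¹ : A) = ↑u⁻¹ := by
    rw [← Units.coe_star, star_inv, hsu]
  -- This is the quotient `a / (a + b)`; it is idempotent because `u * a = a * a`, and it equals one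
  -- only if `b = 0`.
  refine ⟨↑u⁻¹ * a, ⟨?_, ?_⟩, ?_, ?_⟩
  · calc ↑u⁻¹ * a * (↑u⁻¹ * a) = ↑u⁻¹ * (a * ↑u⁻¹) * a := by simp only [mul_assoc]
      _ = ↑u⁻¹ * (↑u⁻¹ * (a * a)) := by rw [← hcomm'.eq]; simp only [mul_assoc]
      _ = ↑u⁻¹ * a := by rw [← hua, Units.inv_mul_cancel_left]
  · rw [IsSelfAdjoint, star_mul, hinv, ha.le.star_eq, hcomm'.eq]
  · intro h0
    exact ha.ne' ((Units.mul_right_eq_zero _).1 h0)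
  · intro h1
    have : a = u := by rw [← Units.mul_inv_cancel_left u a, h1, mul_one]
    rw [hu] at this
    exact hb.ne' (by simpa using this)

theorem orthDistances_nonempty (h : 1 < Module.rank ℂ A) : (orthDistances A).Nonempty :=
  let ⟨p, hp⟩ := orthPairs_nonempty h
  ⟨_, p, hp, rfl⟩

/-- Certifies that `orthDist` is a true infimum and not the default value of `sInf` on `ℝ`. -/
theorem isGLB_orthDist (h : 1 < Module.rank ℂ A) : IsGLB (orthDistances A) (orthDist A) := by
  refine isGLB_csInf (orthDistances_nonempty h) ⟨0, ?_⟩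
  rintro _ ⟨p, -, rfl⟩
  exact norm_nonneg _

theorem orthDist_eq_zero (h : 1 < Module.rank ℂ A) {p : A} (hp : IsStarProjection p)
    (h0 : p ≠ 0) (h1 : p ≠ 1) : orthDist A = 0 := by
  refine (isGLB_orthDist h).unique ⟨?_, fun r hr => ?_⟩
  · rintro _ ⟨p, -, rfl⟩
    exact norm_nonneg _
  · exact hr ⟨(p, 1 - p), one_sub_mem_orthPairs hp h0 h1, by simp⟩

theorem orthDist_eq_one (h : 1 < Module.rank ℂ A)
    (hp : ∀ p : A, IsStarProjection p → p = 0 ∨ p = 1) : orthDist A = 1 := by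
  have : orthDistances A = {1} := by
    refine (orthDistances_nonempty h).subset_singleton_iff.1 ?_
    rintro _ ⟨⟨a, b⟩, hab, rfl⟩
    refine le_antisymm (norm_sub_one_le_one hab) (not_lt.1 fun hlt => ?_)
    obtain ⟨p, hp', h0, h1⟩ := exists_isStarProjection_of_norm_sub_one_lt hab hlt
    exact (hp p hp').elim h0 h1
  rw [orthDist, this, csInf_singleton]

end Unital

/-! ### Projections with scalar corner and finite dimension -/

section Projections

variable {A : Type*} [CStarAlgebra A]

/-- The corner `p * A * p` consists of the scalar multiples of `p`. -/
def IsScalarCorner (p : A) : Prop := ∀ a : A, ∃ c : ℂ, p * a * p = c • p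

/-- `q` is a projection properly contained in the projection `p`. -/
def IsProperSubprojection (q p : A) : Prop :=
  IsStarProjection q ∧ IsStarProjection p ∧ p * q = q ∧ q ≠ p

theorem IsProperSubprojection.mul_eq_left {p q : A} (h : IsProperSubprojection q p) :
    q * p = q := by
  simpa [h.1.isSelfAdjoint.star_eq, h.2.1.isSelfAdjoint.star_eq] using congr(star $(h.2.2.1))

theorem IsProperSubprojection.sub {p q : A} (h : IsProperSubprojection q p) (h0 : q ≠ 0) :
    IsProperSubprojection (p - q) p :=
  ⟨h.1.sub_of_mul_eq_left h.2.1 h.mul_eq_left, h.2.1,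
    by rw [mul_sub, h.2.1.isIdempotentElem.eq, h.2.2.1], by simpa using h0⟩

/-- A non-scalar self-adjoint `y` in the corner has a nonzero spectral value `l`; finiteness of the
spectrum makes the indicator of `l` continuous there, and `q` is the resulting spectral projection.
-/
theorem exists_isProperSubprojection (hA : ∀ x : A, IsSelfAdjoint x → (spectrum ℝ x).Finite)
    {p : A} (hp : IsStarProjection p) (h : ¬ IsScalarCorner p) :
    ∃ q : A, IsProperSubprojection q p ∧ q ≠ 0 := by
  obtain ⟨y, hy, hpy, hyp, hyc⟩ := exists_isSelfAdjoint_not_smul hp h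
  have hy0 : y ≠ 0 := by simpa using hyc 0
  obtain ⟨l, hl, hl0⟩ : ∃ l ∈ spectrum ℝ y, l ≠ 0 := by
    by_contra! hcon
    exact hy0 (CFC.eq_zero_of_spectrum_subset_zero (R := ℝ) y hcon)
  set f : ℝ → ℝ := Pi.single l 1 with hf
  have hfc : ContinuousOn f (spectrum ℝ y) := (hA y hy).continuousOn f
  set q : A := cfc f y with hq
  have hyq : y * q = l • q := by
    nth_rw 1 [← cfc_id ℝ y, hq, ← cfc_mul id f y, ← cfc_smul l f y]
    congr 1
    ext t
    by_cases ht : t = l <;> simp [hf, ht]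
  have hqq : q * q = q := by
    rw [hq, ← cfc_mul f f y]
    congr 1
    ext t
    by_cases ht : t = l <;> simp [hf, ht]
  have hq0 : q ≠ 0 := by
    intro h0
    rw [hq, ← cfc_zero ℝ y, cfc_eq_cfc_iff_eqOn hy hfc] at h0
    simpa [hf] using h0 hl
  refine ⟨q, ⟨⟨hqq, cfc_predicate f y⟩, hp, ?_, ?_⟩, hq0⟩
  -- Since `l ≠ 0`, `q = l⁻¹ • (y * q)`, so `q` inherits `p * y = y`.
  · rw [← inv_smul_smul₀ hl0 q, ← hyq, mul_smul_comm, ← mul_assoc, hpy]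
  · intro hqp
    refine hyc (l : ℂ) ?_
    rw [← hyp, ← hqp, hyq, Complex.coe_smul]

/-- Successive differences along an infinite descending chain would form an infinite orthogonal
family. -/
theorem wellFounded_isProperSubprojection (h : IsCompact (orthImage A)) :
    WellFounded (IsProperSubprojection (A := A)) := by
  rw [wellFounded_iff_isEmpty_descending_chain]
  refine ⟨fun ⟨f, hf⟩ => ?_⟩
  have hsa : ∀ n, star (f n) = f n := fun n => (hf n).2.1.isSelfAdjoint.star_eq
  have hle : ∀ m n, m ≤ n → f m * f n = f n := by
    intro m n hmn
    induction n, hmn using Nat.le_induction with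
    | base => exact (hf m).2.1.isIdempotentElem
    | succ n _ ih =>
      rw [← (hf n).2.2.1, ← mul_assoc, ih]
  have hlt : ∀ m n, m < n → (f m - f (m + 1)) * (f n - f (n + 1)) = 0 := by
    intro m n hmn
    rw [sub_mul, mul_sub, mul_sub, hle m n (by lia), hle m (n + 1) (by lia),
      hle (m + 1) n (by lia), hle (m + 1) (n + 1) (by lia), sub_self]
  have hproj : ∀ n, IsStarProjection (f n - f (n + 1)) := fun n =>
    (hf n).1.sub_of_mul_eq_left (hf n).2.1 (hf n).mul_eq_left
  refine IsOrthFamily.false_of_isCompact (e := fun n => f n - f (n + 1))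
    ⟨fun n => (hproj n).nonneg, fun n => (hproj n).norm_eq_one (sub_ne_zero.2 (hf n).2.2.2.symm),
      fun m n hmn => ?_⟩ h
  rcases hmn.lt_or_gt with hmn | hmn
  · exact hlt m n hmn
  · exact mul_eq_zero_symm_of_nonneg (hproj n).nonneg (hproj m).nonneg (hlt n m hmn)

theorem mem_closure_isScalarCorner (h : IsCompact (orthImage A)) {p : A}
    (hp : IsStarProjection p) :
    p ∈ AddSubmonoid.closure {q : A | IsStarProjection q ∧ IsScalarCorner q} := by
  induction p using (wellFounded_isProperSubprojection h).induction with
  | _ p ih =>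
    by_cases hs : IsScalarCorner p
    · exact AddSubmonoid.subset_closure ⟨hp, hs⟩
    · obtain ⟨q, hq, hq0⟩ := exists_isProperSubprojection
        (fun x => spectrum_finite_of_isCompact_orthImage h) hp hs
      rw [← add_sub_cancel q p]
      exact add_mem (ih q hq hq.1) (ih _ (hq.sub hq0) (hq.sub hq0).1)

/-- Up to a nonzero scalar, `q` is `star v * v`, so `p * a * q` is a multiple of `(p * (a * star v)
* p) * v`, and the corner at `p` is scalar. -/
theorem exists_smul_eq_of_isScalarCorner {p q : A} (hp : IsStarProjection p) (hq : IsStarProjection q)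
    (hpc : IsScalarCorner p) (hqc : IsScalarCorner q) {v : A} (hv0 : v ≠ 0) (hpv : p * v = v)
    (hvq : v * q = v) (a : A) : ∃ c : ℂ, p * a * q = c • v := by
  have hqv : q * star v = star v := by
    simpa [hq.isSelfAdjoint.star_eq] using congr(star $hvq)
  have hvp : star v * p = star v := by
    simpa [hp.isSelfAdjoint.star_eq] using congr(star $hpv)
  obtain ⟨l, hl⟩ := hqc (star v * v)
  have hl' : star v * v = l • q := by
    rw [← hl, ← mul_assoc, hqv, mul_assoc, hvq]
  obtain ⟨c, hc⟩ := hpc (a * star v)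
  have hc' : p * a * star v = c • p := by
    rw [← hc, mul_assoc, mul_assoc, mul_assoc, hvp]
  have hl0 : l ≠ 0 := by
    rintro rfl
    rw [zero_smul, CStarRing.star_mul_self_eq_zero_iff] at hl'
    exact hv0 hl'
  refine ⟨l⁻¹ * c, ?_⟩
  have : l • (p * a * q) = c • v := by
    rw [← mul_smul_comm, ← hl', ← mul_assoc, hc', smul_mul_assoc, hpv]
  rw [mul_smul, ← this, inv_smul_smul₀ hl0]

theorem finiteDimensional_of_isCompact_orthImage (h : IsCompact (orthImage A)) :
    FiniteDimensional ℂ A := by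
  -- The sandwich map is additive in `p` and in `q`, so finite rank spreads from scalar-corner
  -- projections to their sums, and finally to `T 1 1`, the identity.
  let T (p q : A) : A →ₗ[ℂ] A := LinearMap.mulLeftRight ℂ (p, q)
  have hT : ∀ p q a : A, T p q a = p * a * q := fun p q a => LinearMap.mulLeftRight_apply p q a
  have hmin : ∀ p ∈ {q : A | IsStarProjection q ∧ IsScalarCorner q},
      ∀ q ∈ {q : A | IsStarProjection q ∧ IsScalarCorner q},
      FiniteDimensional ℂ (LinearMap.range (T p q)) := by
    rintro p ⟨hp, hpc⟩ q ⟨hq, hqc⟩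
    by_cases h0 : ∀ a, p * a * q = 0
    · have : T p q = 0 := by ext a; simp [hT, h0]
      rw [this, LinearMap.range_zero]
      infer_instance
    · push Not at h0
      obtain ⟨a, ha⟩ := h0
      have hle : LinearMap.range (T p q) ≤ ℂ ∙ (p * a * q) := by
        rintro _ ⟨b, rfl⟩
        obtain ⟨c, hc⟩ := exists_smul_eq_of_isScalarCorner hp hq hpc hqc ha
          (by rw [← mul_assoc, ← mul_assoc, hp.isIdempotentElem.eq])
          (by rw [mul_assoc, hq.isIdempotentElem.eq]) b
        rw [hT, hc]
        exact Submodule.smul_mem _ _ (Submodule.mem_span_singleton_self _)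
      exact Submodule.finiteDimensional_of_le hle
  have hadd : ∀ S U V : A →ₗ[ℂ] A, FiniteDimensional ℂ (LinearMap.range S) →
      FiniteDimensional ℂ (LinearMap.range U) → V = S + U →
      FiniteDimensional ℂ (LinearMap.range V) := by
    rintro S U _ hS hU rfl
    exact Submodule.finiteDimensional_of_le (S₂ := LinearMap.range S ⊔ LinearMap.range U)
      (LinearMap.range_add_le S U)
  have hz : ∀ S : A →ₗ[ℂ] A, S = 0 → FiniteDimensional ℂ (LinearMap.range S) := by
    rintro S rfl
    rw [LinearMap.range_zero]
    infer_instance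
  have hleft : ∀ p ∈ AddSubmonoid.closure {q : A | IsStarProjection q ∧ IsScalarCorner q},
      ∀ q ∈ {q : A | IsStarProjection q ∧ IsScalarCorner q},
      FiniteDimensional ℂ (LinearMap.range (T p q)) := by
    intro p hp q hq
    induction hp using AddSubmonoid.closure_induction with
    | mem p hp => exact hmin p hp q hq
    | zero => exact hz _ (by ext a; simp [hT])
    | add x y _ _ hx hy => exact hadd _ _ _ hx hy (by ext a; simp [hT, add_mul])
  have hboth : ∀ q ∈ AddSubmonoid.closure {q : A | IsStarProjection q ∧ IsScalarCorner q},
      FiniteDimensional ℂ (LinearMap.range (T 1 q)) := by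
    intro q hq
    induction hq using AddSubmonoid.closure_induction with
    | mem q hq => exact hleft 1 (mem_closure_isScalarCorner h (.one A)) q hq
    | zero => exact hz _ (by ext a; simp [hT])
    | add x y _ _ hx hy => exact hadd _ _ _ hx hy (by ext a; simp [hT, mul_add])
  have hall := hboth 1 (mem_closure_isScalarCorner h (.one A))
  have : T 1 1 = LinearMap.id := by ext a; simp [hT]
  rw [this, LinearMap.range_id] at hall
  exact Module.finite_def.2 (Module.Finite.iff_fg.1 hall)

theorem isCompact_orthImage_of_finiteDimensional [FiniteDimensional ℂ A] :
    IsCompact (orthImage A) := by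
  have : ProperSpace A := FiniteDimensional.proper ℂ A
  let K : Set (A × A) := (Metric.sphere 0 1 ×ˢ Metric.sphere 0 1) ∩
    ({p | 0 ≤ p.1} ∩ {p | 0 ≤ p.2} ∩ {p | p.1 * p.2 = 0})
  have hK : IsCompact K := by
    refine ((isCompact_sphere 0 1).prod (isCompact_sphere 0 1)).inter_right
      ((IsClosed.inter ?_ ?_).inter ?_)
    · exact isClosed_le continuous_const continuous_fst
    · exact isClosed_le continuous_const continuous_snd
    · exact isClosed_eq (continuous_fst.mul continuous_snd) continuous_const
  convert hK.image (continuous_fst.add continuous_snd)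
  ext x
  rw [mem_orthImage_iff]
  constructor
  · rintro ⟨a, b, ha, hb, ha1, hb1, hab, rfl⟩
    exact ⟨(a, b), ⟨⟨by simpa using ha1, by simpa using hb1⟩, ⟨ha, hb⟩, hab⟩, rfl⟩
  · rintro ⟨⟨a, b⟩, ⟨⟨ha1, hb1⟩, ⟨ha, hb⟩, hab⟩, rfl⟩
    exact ⟨a, b, ha, hb, by simpa using ha1, by simpa using hb1, hab, rfl⟩

end Projections

/-! ### Finite image: `ℂ²` or `M₂(ℂ)` -/

section FiniteImage

variable {A : Type*} [CStarAlgebra A]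

theorem isStarProjection_of_finite_orthImage (h : (orthImage A).Finite) {a b : A} (ha : 0 ≤ a)
    (hb : 0 ≤ b) (ha1 : ‖a‖ = 1) (hb1 : ‖b‖ = 1) (hab : a * b = 0) : IsStarProjection a := by
  have hsa : IsSelfAdjoint a := .of_nonneg ha
  -- The exponents are powers of two so that the C⋆-identity keeps the norm at one. Two of these
  -- powers must coincide, which forces the spectrum of `a` into `{0, 1}`.
  have hmem : ∀ n : ℕ, a ^ 2 ^ n + b ∈ orthImage A := fun n =>
    mem_orthImage_iff.2 ⟨_, _, CStarAlgebra.pow_nonneg ha _, hb,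
      by rw [hsa.norm_pow_two_pow, ha1, one_pow], hb1,
      by rw [← Nat.sub_add_cancel (Nat.one_le_two_pow (n := n)), pow_succ, mul_assoc, hab,
        mul_zero], rfl⟩
  have := h.to_subtype
  obtain ⟨m, n, hmn, heq⟩ := Finite.exists_ne_map_eq_of_infinite
    fun n : ℕ => (⟨_, hmem n⟩ : orthImage A)
  have hpow : a ^ 2 ^ m = a ^ 2 ^ n := add_right_cancel (Subtype.ext_iff.1 heq)
  rw [isStarProjection_iff_spectrum_subset_and_isSelfAdjoint]
  refine ⟨fun t ht => ?_, hsa⟩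
  have ht0 : 0 ≤ t := spectrum_nonneg_of_nonneg ha ht
  rw [← cfc_pow_id (R := ℝ) a (2 ^ m), ← cfc_pow_id (R := ℝ) a (2 ^ n),
    cfc_eq_cfc_iff_eqOn] at hpow
  by_contra hne
  simp only [Set.mem_insert_iff, Set.mem_singleton_iff, not_or] at hne
  have := pow_right_injective₀ (ht0.lt_of_ne' hne.1) hne.2 (hpow ht)
  exact hmn (Nat.pow_right_injective le_rfl this)

theorem orthImage_subset_one_of_finite (h : (orthImage A).Finite) : orthImage A ⊆ {1} := by
  intro x hx
  obtain ⟨a, b, ha, hb, ha1, hb1, hab, rfl⟩ := mem_orthImage_iff.1 hx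
  have hba := mul_eq_zero_symm_of_nonneg ha hb hab
  have hpa := isStarProjection_of_finite_orthImage h ha hb ha1 hb1 hab
  have hpb := isStarProjection_of_finite_orthImage h hb ha hb1 ha1 hba
  have hpc := (hpa.add hpb hab).one_sub
  by_contra hne
  refine orthImage_infinite_of_three ha hb hpc.nonneg ha1 hb1
    (hpc.norm_eq_one (sub_ne_zero.2 (Ne.symm hne))) hab ?_ ?_ h
  · rw [mul_sub, mul_add, hab, hpa.isIdempotentElem.eq, mul_one, add_zero, sub_self]
  · rw [mul_sub, mul_add, hba, hpb.isIdempotentElem.eq, mul_one, zero_add, sub_self]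

/-- Otherwise `p` splits, and `q`, `p - q`, `1 - p` are three orthogonal projections. -/
theorem isScalarCorner_of_finite_orthImage (h : (orthImage A).Finite) {p : A}
    (hp : IsStarProjection p) (h1 : p ≠ 1) : IsScalarCorner p := by
  by_contra hs
  obtain ⟨q, hq, hq0⟩ := exists_isProperSubprojection
    (fun x => spectrum_finite_of_isCompact_orthImage h.isCompact) hp hs
  have hr := (hq.sub hq0).1
  refine orthImage_infinite_of_three hq.1.nonneg hr.nonneg hp.one_sub.nonneg
    (hq.1.norm_eq_one hq0) (hr.norm_eq_one (sub_ne_zero.2 hq.2.2.2.symm))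
    (hp.one_sub.norm_eq_one (sub_ne_zero.2 h1.symm)) ?_ ?_ ?_ h
  · rw [mul_sub, hq.mul_eq_left, hq.1.isIdempotentElem.eq, sub_self]
  · rw [mul_sub, mul_one, hq.mul_eq_left, sub_self]
  · rw [mul_sub, mul_one, sub_mul, hq.mul_eq_left, hp.isIdempotentElem.eq, sub_self]

theorem nonempty_starAlgEquiv_prod {p q : A} (hp : IsStarProjection p) (hq : IsStarProjection q)
    (hp0 : p ≠ 0) (hq0 : q ≠ 0) (hpq : p * q = 0) (hqp : q * p = 0) (h1 : p + q = 1)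
    (hspan : ∀ a : A, ∃ c d : ℂ, a = c • p + d • q) : Nonempty (A ≃⋆ₐ[ℂ] (ℂ × ℂ)) := by
  have hpp : p * p = p := hp.isIdempotentElem
  have hqq : q * q = q := hq.isIdempotentElem
  let φ : (ℂ × ℂ) →⋆ₐ[ℂ] A :=
    { toFun := fun z => z.1 • p + z.2 • q
      map_one' := by simpa using h1
      map_zero' := by simp
      map_add' := fun x y => by simp only [Prod.fst_add, Prod.snd_add]; module
      map_mul' := fun x y => by
        simp only [Prod.fst_mul, Prod.snd_mul, add_mul, mul_add, smul_mul_smul_comm, hpp, hqq,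
          hpq, hqp, smul_zero]
        module
      commutes' := fun c => by
        simp [Algebra.algebraMap_eq_smul_one, ← h1]
      map_star' := fun x => by
        simp [hp.isSelfAdjoint.star_eq, hq.isSelfAdjoint.star_eq] }
  have hφ : ∀ z, φ z = z.1 • p + z.2 • q := fun z => rfl
  refine ⟨(StarAlgEquiv.ofBijective φ ⟨(injective_iff_map_eq_zero φ).2 fun z hz => ?_,
    fun a => ?_⟩).symm⟩
  · rw [hφ] at hz
    ext
    · simpa [mul_add, hpp, hpq, hp0] using congr(p * $hz)
    · simpa [mul_add, hqq, hqp, hq0] using congr(q * $hz)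
  · obtain ⟨c, d, rfl⟩ := hspan a
    exact ⟨(c, d), rfl⟩

theorem nonempty_starAlgEquiv_matrix {p q v : A} (hp : IsStarProjection p)
    (hq : IsStarProjection q) (hp0 : p ≠ 0) (hpq : p * q = 0) (hqp : q * p = 0)
    (h1 : p + q = 1) (hvv : v * star v = p) (hvv' : star v * v = q) (hpv : p * v = v)
    (hvq : v * q = v) (hspan : ∀ a : A, ∃ c d e f : ℂ, a = c • p + d • v + e • star v + f • q) :
    Nonempty (A ≃⋆ₐ[ℂ] Matrix (Fin 2) (Fin 2) ℂ) := by
  have hpp : p * p = p := hp.isIdempotentElem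
  have hqq : q * q = q := hq.isIdempotentElem
  have hps := hp.isSelfAdjoint.star_eq
  have hqs := hq.isSelfAdjoint.star_eq
  have hqv' : q * star v = star v := by simpa [hqs] using congr(star $hvq)
  have hvp' : star v * p = star v := by simpa [hps] using congr(star $hpv)
  have hqv : q * v = 0 := by rw [← hpv, ← mul_assoc, hqp, zero_mul]
  have hvp : v * p = 0 := by rw [← hvq, mul_assoc, hqp, mul_zero]
  have hpv' : p * star v = 0 := by simpa [hps] using congr(star $hvp)
  have hvq' : star v * q = 0 := by simpa [hqs] using congr(star $hqv)
  have hv2 : v * v = 0 := by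
    nth_rw 1 [← hvq]
    rw [mul_assoc, hqv, mul_zero]
  have hv2' : star v * star v = 0 := by simpa using congr(star $hv2)
  let φ : Matrix (Fin 2) (Fin 2) ℂ →⋆ₐ[ℂ] A :=
    { toFun := fun m => m 0 0 • p + m 0 1 • v + m 1 0 • star v + m 1 1 • q
      map_one' := by simpa using h1
      map_zero' := by simp
      map_add' := fun x y => by simp only [Matrix.add_apply]; module
      map_mul' := fun x y => by
        simp only [Matrix.mul_apply, Fin.sum_univ_two, add_mul, mul_add, smul_mul_smul_comm, hpp,
          hqq, hpq, hqp, hvv, hvv', hpv, hvq, hqv', hvp', hqv, hvp, hpv', hvq', hv2, hv2',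
          smul_zero]
        module
      commutes' := fun c => by
        simp [Algebra.algebraMap_eq_smul_one, ← h1, Matrix.smul_apply]
      map_star' := fun x => by
        simp only [Matrix.star_apply, star_add, star_smul, star_star, hps, hqs]
        module }
  have hφ : ∀ m, φ m = m 0 0 • p + m 0 1 • v + m 1 0 • star v + m 1 1 • q := fun m => rfl
  refine ⟨(StarAlgEquiv.ofBijective φ ⟨(injective_iff_map_eq_zero φ).2 fun m hm => ?_,
    fun a => ?_⟩).symm⟩
  · rw [hφ] at hm
    have key : ∀ c : ℂ, c • p = 0 → c = 0 := fun c hc => (smul_eq_zero.1 hc).resolve_right hp0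
    ext i j
    fin_cases i <;> fin_cases j <;> refine key _ ?_
    -- Compressing by `p` or `v` on the left and `p` or `star v` on the right moves each matrix
    -- entry in turn to the coefficient of `p`.
    · simpa [mul_add, add_mul, hpp, hpq, hvv, hpv, hvq, hvp, hpv', hv2, hp0] using congr(p * $hm * p)
    · simpa [mul_add, add_mul, hpp, hpq, hvv, hpv, hvq, hvp, hpv', hv2, hp0] using congr(p * $hm * star v)
    · simpa [mul_add, add_mul, hpp, hpq, hvv, hpv, hvq, hvp, hpv', hv2, hp0] using congr(v * $hm * p)
    · simpa [mul_add, add_mul, hpp, hpq, hvv, hpv, hvq, hvp, hpv', hv2, hp0] using congr(v * $hm * star v)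
  · obtain ⟨c, d, e, f, rfl⟩ := hspan a
    exact ⟨!![c, d; e, f], by simp [hφ]⟩

/-- Scalar corners and the C⋆-identity give `v * star v = ‖v‖² • p` and `star v * v = ‖v‖² • q`, so
dividing `v` by its norm suffices. -/
theorem exists_partialIsometry {p q v : A} (hp : IsStarProjection p) (hp0 : p ≠ 0)
    (hq : IsStarProjection q) (hq0 : q ≠ 0) (hpc : IsScalarCorner p) (hqc : IsScalarCorner q) (hv0 : v ≠ 0) (hpv : p * v = v)
    (hvq : v * q = v) :
    ∃ w : A, w * star w = p ∧ star w * w = q ∧ p * w = w ∧ w * q = w := by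
  have key : ∀ {p v : A}, IsStarProjection p → p ≠ 0 → IsScalarCorner p → p * v = v →
      v * star v = ((‖v‖ : ℂ) ^ 2) • p := by
    intro p v hp hp0 hpc hpv
    have hvp : star v * p = star v := by
      simpa [hp.isSelfAdjoint.star_eq] using congr(star $hpv)
    obtain ⟨c, hc⟩ := hpc (v * star v)
    have hc' : v * star v = c • p := by
      rw [← hc, ← mul_assoc, hpv, mul_assoc, hvp]
    have hnn : 0 ≤ c • p := hc' ▸ mul_star_self_nonneg v
    have hcn : ‖c‖ = ‖v‖ ^ 2 := by
      rw [sq, ← CStarRing.norm_self_mul_star, hc', norm_smul, hp.norm_eq_one hp0, mul_one]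
    have hcr : star c = c := by
      have : star c • p = c • p := by
        simpa [hp.isSelfAdjoint.star_eq] using hnn.star_eq
      exact smul_left_injective ℂ hp0 this
    obtain ⟨r, rfl⟩ := Complex.conj_eq_iff_real.1 hcr
    have hr : 0 ≤ r := by
      by_contra! hr
      have h0 : 0 ≤ (-r) • p := smul_nonneg (by linarith) hp.nonneg
      rw [Complex.coe_smul] at hnn
      have h2 : r • p = 0 := le_antisymm (by simpa using h0) hnn
      exact (smul_eq_zero.1 h2).elim hr.ne hp0
    rw [Complex.norm_real, Real.norm_of_nonneg hr] at hcn
    rw [hc', hcn, Complex.ofReal_pow]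
  have hqv : q * star v = star v := by
    simpa [hq.isSelfAdjoint.star_eq] using congr(star $hvq)
  have h1 := key hp hp0 hpc hpv
  have h2 := key hq hq0 hqc hqv
  rw [star_star, norm_star] at h2
  have hn : (‖v‖ : ℂ) ≠ 0 := by simpa using hv0
  have hu : (‖v‖ : ℂ)⁻¹ * (‖v‖ : ℂ)⁻¹ * (‖v‖ : ℂ) ^ 2 = 1 := by field_simp
  refine ⟨((‖v‖ : ℂ)⁻¹) • v, ?_, ?_, by rw [mul_smul_comm, hpv], by rw [smul_mul_assoc, hvq]⟩
  · rw [star_smul, smul_mul_smul_comm, h1, smul_smul]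
    simp [hu]
  · rw [star_smul, smul_mul_smul_comm, h2, smul_smul]
    simp [hu]

theorem exists_isStarProjection_of_finite_orthImage (hA : 1 < Module.rank ℂ A)
    (h : (orthImage A).Finite) : ∃ p : A, IsStarProjection p ∧ p ≠ 0 ∧ p ≠ 1 := by
  obtain ⟨⟨a, b⟩, ha, hb, ha1, hb1, hab⟩ := orthPairs_nonempty hA
  refine ⟨a, isStarProjection_of_finite_orthImage h ha.le hb.le ha1 hb1 hab, ha.ne', ?_⟩
  intro h1
  simp only [h1, one_mul] at hab
  exact hb.ne' hab

theorem orthImage_eq_one_of_finite (hA : 1 < Module.rank ℂ A) (h : (orthImage A).Finite) :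
    orthImage A = {1} :=
  have ⟨p, hp⟩ := orthPairs_nonempty hA
  Set.Nonempty.subset_singleton_iff ⟨_, Set.mem_range_self ⟨p, hp⟩⟩ |>.1
    (orthImage_subset_one_of_finite h)

theorem nonempty_starAlgEquiv_of_finite_orthImage (hA : 1 < Module.rank ℂ A)
    (h : (orthImage A).Finite) :
    Nonempty (A ≃⋆ₐ[ℂ] (ℂ × ℂ)) ∨ Nonempty (A ≃⋆ₐ[ℂ] Matrix (Fin 2) (Fin 2) ℂ) := by
  obtain ⟨p, hp, hp0, hp1⟩ := exists_isStarProjection_of_finite_orthImage hA h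
  obtain ⟨q, hq, hq0, hpq, hqp, h1, hqc⟩ : ∃ q : A, IsStarProjection q ∧ q ≠ 0 ∧ p * q = 0 ∧
      q * p = 0 ∧ p + q = 1 ∧ IsScalarCorner q :=
    ⟨1 - p, hp.one_sub, sub_ne_zero.2 hp1.symm, hp.mul_one_sub_self, hp.one_sub_mul_self,
      add_sub_cancel _ _, isScalarCorner_of_finite_orthImage h hp.one_sub (by simpa using hp0)⟩
  have hpc := isScalarCorner_of_finite_orthImage h hp hp1
  have hdec : ∀ a : A, a = p * a * p + p * a * q + q * a * p + q * a * q := by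
    intro a
    calc a = (p + q) * a * (p + q) := by rw [h1, one_mul, mul_one]
      _ = _ := by noncomm_ring
  have hstar : ∀ a : A, q * a * p = star (p * star a * q) := by
    intro a
    simp [hp.isSelfAdjoint.star_eq, hq.isSelfAdjoint.star_eq, mul_assoc]
  by_cases h0 : ∀ a, p * a * q = 0
  · left
    refine nonempty_starAlgEquiv_prod hp hq hp0 hq0 hpq hqp h1 fun a => ?_
    obtain ⟨c, hc⟩ := hpc a
    obtain ⟨d, hd⟩ := hqc a
    refine ⟨c, d, (hdec a).trans ?_⟩
    rw [hstar, h0, h0, hc, hd, star_zero, add_zero, add_zero]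
  · right
    push Not at h0
    obtain ⟨b, hb⟩ := h0
    obtain ⟨w, hww, hww', hpw, hwq⟩ := exists_partialIsometry hp hp0 hq hq0 hpc hqc hb
      (by rw [← mul_assoc, ← mul_assoc, hp.isIdempotentElem.eq])
      (by rw [mul_assoc, hq.isIdempotentElem.eq])
    have hw0 : w ≠ 0 := by
      rintro rfl
      exact hp0 (by rw [← hww, zero_mul])
    refine nonempty_starAlgEquiv_matrix hp hq hp0 hpq hqp h1 hww hww' hpw hwq fun a => ?_
    obtain ⟨c, hc⟩ := hpc a
    obtain ⟨d, hd⟩ := exists_smul_eq_of_isScalarCorner hp hq hpc hqc hw0 hpw hwq a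
    obtain ⟨e, he⟩ := exists_smul_eq_of_isScalarCorner hp hq hpc hqc hw0 hpw hwq (star a)
    obtain ⟨f, hf⟩ := hqc a
    -- The coefficient of `star w` comes from `q * a * p = star (p * star a * q)`.
    refine ⟨c, d, star e, f, (hdec a).trans ?_⟩
    rw [hstar, hc, hd, he, hf, star_smul]

end FiniteImage

end OrthogonalSums

theorem proposition3 (A : Type*) [CStarAlgebra A] :
    -- (i) the image lies in the unit sphere; `d ∈ {0, 1}`; `d = 1` iff no nontrivial projection
    (orthImage A ⊆ Metric.sphere (0 : A) 1 ∧
      (1 < Module.rank ℂ A →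
        IsGLB (orthDistances A) (orthDist A) ∧
        (orthDist A = 0 ∨ orthDist A = 1) ∧
        (orthDist A = 1 ↔ ∀ p : A, IsStarProjection p → p = 0 ∨ p = 1))) ∧
    -- (ii) closedness of the image is hereditary (for subalgebras and for embeddings)
    (IsClosed (orthImage A) →
      (∀ (S : NonUnitalStarSubalgebra ℂ A) [IsClosed (S : Set A)],
        IsHereditarySubalgebra S → IsClosed (orthImage S)) ∧
      (∀ (B : Type*) [NonUnitalCStarAlgebra B] (ψ : B →⋆ₙₐ[ℂ] A),
        IsHereditaryEmbedding ψ → IsClosed (orthImage B))) ∧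
    -- (iii) finite image
    (1 < Module.rank ℂ A → (orthImage A).Finite →
      orthImage A = {1} ∧
      (Nonempty (A ≃⋆ₐ[ℂ] (ℂ × ℂ)) ∨ Nonempty (A ≃⋆ₐ[ℂ] Matrix (Fin 2) (Fin 2) ℂ))) ∧
    -- (iv) compact image
    (IsCompact (orthImage A) ↔ FiniteDimensional ℂ A) := by
  refine ⟨⟨orthImage_subset_sphere, fun hA => ⟨isGLB_orthDist hA, ?_⟩⟩,
    fun hcl => ⟨fun S _ hS =>
      isClosed_orthImage_of_isHereditaryEmbedding hcl (isHereditaryEmbedding_subtype hS),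
      fun B _ ψ hψ => isClosed_orthImage_of_isHereditaryEmbedding hcl hψ⟩,
    fun hA h => ⟨orthImage_eq_one_of_finite hA h, nonempty_starAlgEquiv_of_finite_orthImage hA h⟩,
    finiteDimensional_of_isCompact_orthImage, fun _ => isCompact_orthImage_of_finiteDimensional⟩
  by_cases hp : ∀ p : A, IsStarProjection p → p = 0 ∨ p = 1
  · have h1 := orthDist_eq_one hA hp
    exact ⟨.inr h1, fun _ => hp, fun _ => h1⟩
  · have hp' := hp
    push Not at hp'
    obtain ⟨p, hpp, hp0, hp1⟩ := hp'
    have h0 := orthDist_eq_zero hA hpp hp0 hp1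
    exact ⟨.inl h0, fun h => by simp [h0] at h, fun h => absurd h hp⟩
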